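/- Let $X$ be a complex Banach space and let $T$ be a bounded linear operator on $X$ that is Tadmor--Ritt, i.e. its spectrum satisfies $\sigma(T)\subset\overline{\mathbb D}$ (with $\mathbb D$ the open unit disc in $\mathbb C$) and $$C(T):=\sup_{|z|>1}\|(z-1)(zI-T)^{-1}\|<\infty .$$ Let $m,n$ be integers with $0\le m\le n$, and let $p(z)=\sum_{k=m}^{n}a_kz^k$ be a polynomial with complex coefficients. Then, for every $s\in(0,1)$, $$\|p(T)\|\le a\,C(T)\left(2\log C(T)+b+\log\frac{n+1}{m+1}\right)\|p\|_{\infty,\mathbb D},\qquad a=\frac{2e}{\pi(1-s)},\quad b=-2\log s+6,$$ where $\|p\|_{\infty,\mathbb D}=\sup_{z\in\mathbb D}|p(z)|$. (For $X=\{0\}$, where $C(T)=0$, the right-hand side is read as $0$.) -/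

import Mathlib

/-- The values `‖(z - 1) R(z, T)‖` for `|z| > 1`, where `R(z, T) = (z I - T)⁻¹`. -/
noncomputable def rittValue {X : Type*} [NormedAddCommGroup X] [NormedSpace ℂ X]
    (T : X →L[ℂ] X) (z : {z : ℂ // 1 < ‖z‖}) : ℝ :=
  ‖((z : ℂ) - 1) • resolvent T (z : ℂ)‖

/-- `C(T) = sup_{|z| > 1} ‖(z - 1) R(z, T)‖`
(a genuine supremum as soon as the values are bounded, see `IsTadmorRitt`). -/
noncomputable def tadmorRittConst {X : Type*} [NormedAddCommGroup X] [NormedSpace ℂ X]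
    (T : X →L[ℂ] X) : ℝ :=
  ⨆ z : {z : ℂ // 1 < ‖z‖}, rittValue T z

/-- A bounded operator `T` is Tadmor–Ritt if its spectrum lies in the closed unit disc and
`C(T) < ∞`. -/
def IsTadmorRitt {X : Type*} [NormedAddCommGroup X] [NormedSpace ℂ X]
    (T : X →L[ℂ] X) : Prop :=
  spectrum ℂ T ⊆ Metric.closedBall (0 : ℂ) 1 ∧ BddAbove (Set.range (rittValue T))

/-- The supremum norm `‖f‖_{∞, Ω}` of a function bounded on `Ω ⊆ ℂ`. -/
noncomputable def supNormOn (Ω : Set ℂ) (f : ℂ → ℂ) : ℝ :=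
  ⨆ z : Ω, ‖f z‖

/-! Put `G(z) = ∑ c k / (1 - q^(k+1)) * z^(k+1)`, so that `G(z) - G(qz) = z p(z)`. Cauchy's formula
on `|w| = r` and `|w| = r/q` gives `2π p(T) = ∫ G(w) (R(w,T) - R(w/q,T)) dθ`
(`integral_dilation_quotient_smul`). A single resolvent is only known to be `O(C/|θ|)`, which costs
a logarithm all the way up to `|θ| = π`; the difference is also `O(C² x/θ²)`, where `q = e^(-2x)`.

Take `r = e^δ`, `δ = 1/(n+1)`, `x = 1/(m+1)`. By the maximum principle and Bernstein growth, `|G| ≤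
e ‖p‖ / (1 - e⁻²)` on `|w| = r` (`norm_sum_dilation_quotient_le`). The kernel has `L¹` norm of order
`C (1 + log(U/δ) + log(U/x))`, where `U ~ C x` is the angle at which the quadratic decay takes over
(`IsTadmorRitt.integral_norm_resolvent_sub_resolvent_le`). The two logarithms add up to `2 log C +
log(x/δ)` plus a constant, and `x/δ = (n+1)/(m+1)`. -/

/-! ### Real integrals of truncated kernels. -/

theorem integral_inv_max_le {a U : ℝ} (ha : 0 < a) (haU : a ≤ U) :
    ∫ x in (0 : ℝ)..U, (max a x)⁻¹ = 1 + Real.log (U / a) := by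
  have hc : Continuous fun x : ℝ => (max a x)⁻¹ :=
    (continuous_const.max continuous_id).inv₀ fun x => (lt_max_of_lt_left ha).ne'
  rw [← intervalIntegral.integral_add_adjacent_intervals (b := a)
    (hc.intervalIntegrable _ _) (hc.intervalIntegrable _ _)]
  congr 1
  · rw [intervalIntegral.integral_congr (g := fun _ => a⁻¹)]
    · simp [ha.ne']
    · intro x hx
      rw [Set.uIcc_of_le ha.le] at hx
      simp [max_eq_left hx.2]
  · rw [← integral_inv_of_pos ha (ha.trans_le haU)]
    refine intervalIntegral.integral_congr fun x hx => ?_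
    rw [Set.uIcc_of_le haU] at hx
    simp [max_eq_right hx.1]

/-- An estimate of `∫₀ᴸ k` for a function which grows like `1 / x` towards the scales `a` and `b`
and decays like `1 / x²` at infinity. -/
theorem integral_le_of_two_scales {k : ℝ → ℝ} (hk : Continuous k) {a b U B E L : ℝ}
    (ha : 0 < a) (hb : 0 < b) (haU : a ≤ U) (hbU : b ≤ U) (hB : 0 ≤ B) (hE : 0 ≤ E) (hL : 0 ≤ L)
    (h₁ : ∀ x, 0 ≤ x → x ≤ L → k x ≤ B * ((max a x)⁻¹ + (max b x)⁻¹))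
    (h₂ : ∀ x, 0 < x → x ≤ L → k x ≤ E / x ^ 2) :
    ∫ x in (0 : ℝ)..L, k x ≤ B * (2 + Real.log (U / a) + Real.log (U / b)) + E / U := by
  have hU : 0 < U := ha.trans_le haU
  have hc : ∀ {d : ℝ}, 0 < d → Continuous fun x : ℝ => (max d x)⁻¹ := fun {d} hd =>
    (continuous_const.max continuous_id).inv₀ fun x => (lt_max_of_lt_left hd).ne'
  have hgc : Continuous fun x : ℝ => B * ((max a x)⁻¹ + (max b x)⁻¹) :=
    continuous_const.mul ((hc ha).add (hc hb))
  have hg : ∫ x in (0 : ℝ)..U, B * ((max a x)⁻¹ + (max b x)⁻¹) =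
      B * (2 + Real.log (U / a) + Real.log (U / b)) := by
    rw [intervalIntegral.integral_const_mul, intervalIntegral.integral_add
      ((hc ha).intervalIntegrable _ _) ((hc hb).intervalIntegrable _ _),
      integral_inv_max_le ha haU, integral_inv_max_le hb hbU]
    ring
  have hg0 : ∀ x : ℝ, 0 ≤ B * ((max a x)⁻¹ + (max b x)⁻¹) := fun x => by
    have h1 : 0 < max a x := lt_max_of_lt_left ha
    have h2 : 0 < max b x := lt_max_of_lt_left hb
    positivity
  have near : ∀ V, 0 ≤ V → V ≤ U → V ≤ L → ∫ x in (0 : ℝ)..V, k x ≤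
      B * (2 + Real.log (U / a) + Real.log (U / b)) := by
    intro V hV hVU hVL
    rw [← hg]
    refine (intervalIntegral.integral_mono_on hV (hk.intervalIntegrable _ _)
      (hgc.intervalIntegrable _ _) fun x hx => h₁ x hx.1 (hx.2.trans hVL)).trans ?_
    exact intervalIntegral.integral_mono_interval le_rfl hV hVU
      (Filter.Eventually.of_forall hg0) (hgc.intervalIntegrable _ _)
  rcases le_total L U with h | h
  · exact (near L hL h le_rfl).trans (le_add_of_nonneg_right (by positivity))
  · rw [← intervalIntegral.integral_add_adjacent_intervals (b := U)
      (hk.intervalIntegrable _ _) (hk.intervalIntegrable _ _)]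
    refine add_le_add (near U hU.le le_rfl h) ?_
    have h0 : (0 : ℝ) ∉ Set.uIcc U L := by
      rw [Set.uIcc_of_le h]
      exact fun hx => hU.not_ge hx.1
    have hi : IntervalIntegrable (fun x : ℝ => E * x ^ (-2 : ℤ)) MeasureTheory.volume U L :=
      (intervalIntegral.intervalIntegrable_zpow (Or.inr h0)).const_mul _
    refine (intervalIntegral.integral_mono_on h (hk.intervalIntegrable _ _) hi
      fun x hx => (h₂ x (hU.trans_le hx.1) hx.2).trans_eq ?_).trans ?_
    · rw [zpow_neg, div_eq_mul_inv]
      norm_cast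
    · rw [intervalIntegral.integral_const_mul, integral_zpow (Or.inr ⟨by norm_num, h0⟩),
        div_eq_mul_inv E U]
      refine mul_le_mul_of_nonneg_left ?_ hE
      have : 0 ≤ L⁻¹ := inv_nonneg.mpr hL
      norm_num [div_neg]
      linarith

/-! ### Circles around the origin seen from `1`. -/

/-- Distance from `1` to the points of a circle around the origin. -/
theorem sub_one_le_norm_circleMap_sub_one {ρ : ℝ} (hρ : 0 ≤ ρ) (θ : ℝ) :
    ρ - 1 ≤ ‖circleMap 0 ρ θ - 1‖ := by
  simpa [abs_of_nonneg hρ] using norm_sub_norm_le (circleMap 0 ρ θ) 1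

/-- From `|ρ e^(iθ) - 1|² = (ρ-1)² + 4ρ sin²(θ/2)` and Jordan's inequality. The factor `√ρ` is kept
because it later cancels the radii in the resolvent identity exactly. -/
theorem sqrt_mul_le_norm_circleMap_sub_one {ρ : ℝ} (hρ : 0 ≤ ρ) {θ : ℝ} (hθ : |θ| ≤ Real.pi) :
    √ρ * (2 / Real.pi * |θ|) ≤ ‖circleMap 0 ρ θ - 1‖ := by
  have hs : 2 / Real.pi * |θ| ≤ 2 * Real.sin (|θ| / 2) := by
    have := Real.mul_le_sin (x := |θ| / 2) (by positivity) (by linarith)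
    linarith
  have hn : ‖circleMap 0 ρ θ - 1‖ ^ 2 = (ρ - 1) ^ 2 + ρ * (2 * Real.sin (|θ| / 2)) ^ 2 := by
    have hcos : Real.cos θ = 1 - 2 * Real.sin (|θ| / 2) ^ 2 := by
      rw [← Real.cos_abs θ, ← Real.cos_sq_add_sin_sq (|θ| / 2),
        show Real.cos |θ| = Real.cos (2 * (|θ| / 2)) by ring_nf, Real.cos_two_mul]
      linarith [Real.cos_sq_add_sin_sq (|θ| / 2)]
    rw [← Complex.normSq_eq_norm_sq, Complex.normSq_apply]
    simp only [Complex.sub_re, Complex.sub_im, Complex.one_re, Complex.one_im, circleMap, zero_add,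
      Complex.re_ofReal_mul, Complex.im_ofReal_mul, Complex.exp_ofReal_mul_I_re,
      Complex.exp_ofReal_mul_I_im]
    have := Real.cos_sq_add_sin_sq θ
    linear_combination ρ ^ 2 * this - 2 * ρ * hcos
  refine (sq_le_sq₀ (by positivity) (norm_nonneg _)).mp ?_
  rw [hn, mul_pow, Real.sq_sqrt hρ]
  have := mul_le_mul_of_nonneg_left (pow_le_pow_left₀ (by positivity) hs 2) hρ
  nlinarith [sq_nonneg (ρ - 1)]

/-! ### Polynomial bounds inside and outside the disc. -/

/-- Maximum principle for polynomials on the unit disc. -/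
theorem Polynomial.norm_eval_le_of_unit_circle (P : Polynomial ℂ) {B : ℝ}
    (h : ∀ z : ℂ, ‖z‖ = 1 → ‖P.eval z‖ ≤ B) {z : ℂ} (hz : ‖z‖ ≤ 1) : ‖P.eval z‖ ≤ B := by
  refine Complex.norm_le_of_forall_mem_frontier_norm_le (U := Metric.ball (0 : ℂ) 1)
    Metric.isBounded_ball P.differentiable.diffContOnCl (fun w hw => h w ?_) ?_
  · rw [frontier_ball _ one_ne_zero] at hw
    simpa using hw
  · rw [closure_ball _ one_ne_zero]
    simpa using hz

/-- Bernstein's growth estimate outside of the unit disc. -/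
theorem Polynomial.norm_eval_le_pow_of_unit_circle (P : Polynomial ℂ) {B : ℝ} {d : ℕ}
    (hd : P.natDegree ≤ d) (h : ∀ z : ℂ, ‖z‖ = 1 → ‖P.eval z‖ ≤ B) {w : ℂ} (hw : 1 ≤ ‖w‖) :
    ‖P.eval w‖ ≤ ‖w‖ ^ d * B := by
  -- The reflected polynomial is `z^d P(1/z)`: it obeys the same bound on the unit circle, and its
  -- values inside the disc control `P` outside.
  have key : ∀ z : ℂ, z ≠ 0 → ‖P.eval z‖ = ‖z‖ ^ d * ‖(P.reflect d).eval z⁻¹‖ := by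
    intro z hz
    let _ := invertibleOfNonzero hz
    have := Polynomial.eval₂_reflect_mul_pow (RingHom.id ℂ) z d P hd
    rw [invOf_eq_inv, Polynomial.eval₂_id, Polynomial.eval₂_id] at this
    rw [← this, norm_mul, norm_pow, mul_comm]
  have hw0 : w ≠ 0 := norm_pos_iff.mp (by linarith)
  rw [key w hw0]
  refine mul_le_mul_of_nonneg_left ?_ (by positivity)
  refine (P.reflect d).norm_eval_le_of_unit_circle (fun z hz => ?_) ?_
  · have hz0 : z ≠ 0 := norm_pos_iff.mp (by linarith)
    have := key z⁻¹ (inv_ne_zero hz0)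
    simp only [norm_inv, hz, inv_one, one_pow, one_mul, inv_inv] at this
    rw [← this]
    exact h _ (by simp [hz])
  · rw [norm_inv]
    exact inv_le_one_of_one_le₀ hw

/-- A polynomial `∑ aₖ zᵏ`, `m ≤ k ≤ n`, bounded by `S` on the unit disc, is written as
`G(z) - G(qz) = z p(z)`, with a bound of `G` on a larger circle. -/
theorem norm_sum_dilation_quotient_le {m n : ℕ} (hmn : m ≤ n) (c : ℕ → ℂ) {S q : ℝ}
    (hq0 : 0 ≤ q) (hq1 : q < 1)
    (hS : ∀ z : ℂ, ‖z‖ = 1 → ‖∑ k ∈ Finset.Icc m n, c k * z ^ k‖ ≤ S) {w : ℂ} (hw : 1 ≤ ‖w‖) :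
    ‖∑ k ∈ Finset.Icc m n, c k / (1 - (q : ℂ) ^ (k + 1)) * w ^ (k + 1)‖ ≤
      ‖w‖ ^ (n + 1) * (S / (1 - q ^ (m + 1))) := by
  set g : ℕ → ℂ := fun k => c k / (1 - (q : ℂ) ^ (k + 1)) with hg
  have hqk : ∀ k : ℕ, q ^ (k + 1) < 1 := fun k => pow_lt_one₀ hq0 hq1 (by omega)
  have hgc : ∀ k, g k - (q : ℂ) ^ (k + 1) * g k = c k := fun k => by
    have : (1 : ℂ) - (q : ℂ) ^ (k + 1) ≠ 0 := by
      have h1 : (1 : ℝ) - q ^ (k + 1) ≠ 0 := (sub_pos.mpr (hqk k)).ne'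
      exact_mod_cast h1
    rw [hg]
    field_simp
  -- `G(z) = z^(m+1) H(z)`; with this power removed, dilation by `q` gains the full factor
  -- `q^(m+1)`.
  set H : Polynomial ℂ := ∑ k ∈ Finset.Icc m n, Polynomial.monomial (k - m) (g k) with hH
  have hHe : ∀ z, H.eval z = ∑ k ∈ Finset.Icc m n, g k * z ^ (k - m) := fun z => by
    simp [hH, Polynomial.eval_finsetSum]
  have hHd : H.natDegree ≤ n - m := by
    refine Polynomial.natDegree_sum_le_of_forall_le _ _ fun k hk => ?_
    have := Finset.mem_Icc.mp hk
    exact (Polynomial.natDegree_monomial_le _).trans (by omega)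
  have hpow : ∀ z : ℂ, z ^ (m + 1) * H.eval z =
      ∑ k ∈ Finset.Icc m n, g k * z ^ (k + 1) := fun z => by
    rw [hHe, Finset.mul_sum]
    refine Finset.sum_congr rfl fun k hk => ?_
    have := Finset.mem_Icc.mp hk
    rw [show k + 1 = (m + 1) + (k - m) by omega, pow_add]
    ring
  have hdil : ∀ z : ℂ, z ^ (m + 1) * (H.eval z - (q : ℂ) ^ (m + 1) * H.eval (q * z)) =
      z * ∑ k ∈ Finset.Icc m n, c k * z ^ k := fun z => by
    rw [mul_sub, hpow, show z ^ (m + 1) * ((q : ℂ) ^ (m + 1) * H.eval (q * z)) =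
      (q * z) ^ (m + 1) * H.eval (q * z) by ring, hpow, ← Finset.sum_sub_distrib, Finset.mul_sum]
    refine Finset.sum_congr rfl fun k _ => ?_
    rw [← hgc k]
    ring
  obtain ⟨z₀, hz₀, hmax⟩ := (isCompact_sphere (0 : ℂ) 1).exists_isMaxOn
    (NormedSpace.sphere_nonempty.mpr zero_le_one) H.continuous.norm.continuousOn
  have hmax' : ∀ z : ℂ, ‖z‖ = 1 → ‖H.eval z‖ ≤ ‖H.eval z₀‖ := fun z hz =>
    hmax (by simpa using hz)
  have hz₀ : ‖z₀‖ = 1 := by simpa using hz₀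
  -- At a maximum point `z₀` on the circle, `|H(z₀)| ≤ S + q^(m+1) |H(q z₀)| ≤ S + q^(m+1) |H(z₀)|`.
  have hB : ‖H.eval z₀‖ ≤ S / (1 - q ^ (m + 1)) := by
    rw [le_div_iff₀ (sub_pos.mpr (hqk m))]
    have h1 := congrArg norm (hdil z₀)
    rw [norm_mul, norm_pow, hz₀, one_pow, one_mul, norm_mul, hz₀, one_mul] at h1
    have h2 : ‖H.eval (q * z₀)‖ ≤ ‖H.eval z₀‖ := H.norm_eval_le_of_unit_circle hmax'
      (by rw [norm_mul, hz₀, mul_one, Complex.norm_of_nonneg hq0]; exact hq1.le)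
    have h3 : ‖(q : ℂ) ^ (m + 1) * H.eval (q * z₀)‖ ≤ q ^ (m + 1) * ‖H.eval z₀‖ := by
      rw [norm_mul, norm_pow, Complex.norm_of_nonneg hq0]
      gcongr
    have h4 := norm_sub_norm_le (H.eval z₀) ((q : ℂ) ^ (m + 1) * H.eval (q * z₀))
    have h5 := hS z₀ hz₀
    linarith
  rw [← hpow, norm_mul, norm_pow]
  have := H.norm_eval_le_pow_of_unit_circle hHd
    (fun z hz => (hmax' z hz).trans hB) hw
  calc ‖w‖ ^ (m + 1) * ‖H.eval w‖
      ≤ ‖w‖ ^ (m + 1) * (‖w‖ ^ (n - m) * (S / (1 - q ^ (m + 1)))) := by gcongr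
    _ = ‖w‖ ^ (n + 1) * (S / (1 - q ^ (m + 1))) := by
      rw [← mul_assoc, ← pow_add, show m + 1 + (n - m) = n + 1 by omega]

/-! ### Resolvents and Cauchy formulas. -/

section Operator

variable {X : Type*} [NormedAddCommGroup X] [NormedSpace ℂ X]

theorem IsTadmorRitt.mem_resolventSet {T : X →L[ℂ] X} (hT : IsTadmorRitt T) {z : ℂ}
    (hz : 1 < ‖z‖) : z ∈ resolventSet ℂ T := by
  by_contra h
  have := hT.1 h
  rw [mem_closedBall_zero_iff] at this
  linarith

theorem IsTadmorRitt.norm_resolvent_le {T : X →L[ℂ] X} (hT : IsTadmorRitt T) {z : ℂ}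
    (hz : 1 < ‖z‖) : ‖resolvent T z‖ ≤ tadmorRittConst T / ‖z - 1‖ := by
  have h1 : 0 < ‖z - 1‖ := norm_pos_iff.mpr (sub_ne_zero.mpr fun h => by simp [h] at hz)
  rw [le_div_iff₀ h1, mul_comm, ← norm_smul]
  exact le_ciSup hT.2 ⟨z, hz⟩

theorem tadmorRittConst_nonneg (T : X →L[ℂ] X) : 0 ≤ tadmorRittConst T :=
  Real.iSup_nonneg fun _ => norm_nonneg _

/-- `(z - 1) R(z,T)` tends to the identity, of norm `1`, as `z → ∞`; a large real `z = t` makes the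
error at most `ε`. -/
theorem IsTadmorRitt.one_le_tadmorRittConst [Nontrivial X] {T : X →L[ℂ] X}
    (hT : IsTadmorRitt T) : 1 ≤ tadmorRittConst T := by
  set C := tadmorRittConst T
  have hC : 0 ≤ C := tadmorRittConst_nonneg T
  refine le_of_forall_pos_le_add fun ε hε => ?_
  set t : ℝ := 2 + C * (1 + ‖T‖) / ε with ht
  have ht1 : 1 < t := by
    have : 0 ≤ C * (1 + ‖T‖) / ε := by positivity
    linarith
  have hz : 1 < ‖(t : ℂ)‖ := by rwa [Complex.norm_of_nonneg (by linarith)]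
  have hR := hT.norm_resolvent_le hz
  have h1 : ‖(t : ℂ) - 1‖ = t - 1 := by
    rw [← Complex.ofReal_one, ← Complex.ofReal_sub, Complex.norm_of_nonneg (by linarith)]
  rw [h1, le_div_iff₀ (by linarith)] at hR
  have hid : (algebraMap ℂ (X →L[ℂ] X) t - T) * resolvent T (t : ℂ) = 1 :=
    Ring.mul_inverse_cancel _ (hT.mem_resolventSet hz)
  have h2 : 1 ≤ (t + ‖T‖) * ‖resolvent T (t : ℂ)‖ := by
    calc (1 : ℝ) = ‖(1 : X →L[ℂ] X)‖ := norm_one.symm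
      _ ≤ ‖algebraMap ℂ (X →L[ℂ] X) t - T‖ * ‖resolvent T (t : ℂ)‖ := by
        rw [← hid]; exact norm_mul_le _ _
      _ ≤ _ := by
        gcongr
        refine (norm_sub_le _ _).trans ?_
        rw [norm_algebraMap', Complex.norm_of_nonneg (by linarith)]
  have h3 : C * (1 + ‖T‖) ≤ ε * (t - 1) := by
    have : ε * (t - 1) = ε + C * (1 + ‖T‖) := by rw [ht]; field_simp; ring
    linarith
  have h4 : (t - 1) ≤ (t + ‖T‖) * C := by
    calc t - 1 ≤ (t + ‖T‖) * ‖resolvent T (t : ℂ)‖ * (t - 1) :=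
          le_mul_of_one_le_left (by linarith) h2
      _ = (t + ‖T‖) * (‖resolvent T (t : ℂ)‖ * (t - 1)) := by ring
      _ ≤ _ := by gcongr
  have h5 : (t - 1) * 1 ≤ (t - 1) * (C + ε) := by linarith
  exact le_of_mul_le_mul_left h5 (by linarith)

/-- The first resolvent identity. -/
theorem resolvent_sub_resolvent_eq_smul {T : X →L[ℂ] X} {z w : ℂ} (hz : z ∈ resolventSet ℂ T)
    (hw : w ∈ resolventSet ℂ T) :
    resolvent T z - resolvent T w = (w - z) • (resolvent T z * resolvent T w) := by
  have h1 : resolvent T z * (algebraMap ℂ (X →L[ℂ] X) z - T) = 1 := Ring.inverse_mul_cancel _ hz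
  have h2 : (algebraMap ℂ (X →L[ℂ] X) w - T) * resolvent T w = 1 := Ring.mul_inverse_cancel _ hw
  calc resolvent T z - resolvent T w
      = resolvent T z * ((algebraMap ℂ (X →L[ℂ] X) w - T) * resolvent T w) -
          resolvent T z * (algebraMap ℂ (X →L[ℂ] X) z - T) * resolvent T w := by
        rw [h1, h2, one_mul, mul_one]
    _ = resolvent T z * ((algebraMap ℂ (X →L[ℂ] X) w - algebraMap ℂ (X →L[ℂ] X) z)) *
          resolvent T w := by noncomm_ring
    _ = _ := by
      rw [← map_sub, Algebra.algebraMap_eq_smul_one, mul_smul_comm, mul_one, smul_mul_assoc]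

variable [CompleteSpace X]

theorem continuous_resolvent_circleMap {T : X →L[ℂ] X}
    (hT : spectrum ℂ T ⊆ Metric.closedBall 0 1) {ρ : ℝ} (hρ : 1 < ρ) :
    Continuous fun θ => resolvent T (circleMap 0 ρ θ) := by
  refine continuous_iff_continuousAt.mpr fun θ => ?_
  have h : circleMap 0 ρ θ ∈ resolventSet ℂ T := by
    by_contra h
    have := hT h
    simp only [mem_closedBall_zero_iff, norm_circleMap_zero] at this
    linarith [le_abs_self ρ]
  exact (spectrum.hasDerivAt_resolvent_const_left h).continuousAt.comp
    (f := circleMap 0 ρ) (continuous_circleMap 0 ρ).continuousAt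

/-- Cauchy's formula for the powers of an operator with spectrum in the closed unit disc. -/
theorem integral_pow_smul_resolvent {T : X →L[ℂ] X}
    (hT : spectrum ℂ T ⊆ Metric.closedBall 0 1) {ρ : ℝ} (hρ : 1 < ρ) (k : ℕ) :
    ∫ θ in (-Real.pi)..Real.pi, circleMap 0 ρ θ ^ (k + 1) • resolvent T (circleMap 0 ρ θ) =
      (2 * Real.pi : ℂ) • T ^ k := by
  have hρ0 : 0 < ρ := by linarith
  set R : NNReal := ⟨ρ⁻¹, by positivity⟩ with hR
  have hRρ : (R : ℝ) = ρ⁻¹ := rfl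
  have hrad : spectralRadius ℂ T ≤ 1 := by
    refine iSup₂_le fun z hz => ?_
    have := hT hz
    rw [mem_closedBall_zero_iff] at this
    exact_mod_cast this
  have hlt : (R : ENNReal) < (spectralRadius ℂ T)⁻¹ := by
    refine lt_of_lt_of_le ?_ (ENNReal.one_le_inv.mpr hrad)
    rw [ENNReal.coe_lt_one_iff, ← NNReal.coe_lt_one, hRρ]
    exact inv_lt_one_of_one_lt₀ hρ
  have hf := (spectrum.differentiableOn_inverse_one_sub_smul hlt).hasFPowerSeriesOnBall
    (show 0 < R from NNReal.coe_pos.mp (by rw [hRρ]; positivity))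
  -- Uniqueness of the expansion at `0`: the Cauchy coefficients of `(1 - zT)⁻¹` are the Neumann
  -- coefficients `T^k`. The inversion `w = 1/z`, which reverses the angle, carries this to the
  -- circle of radius `ρ`.
  have heq := hf.hasFPowerSeriesAt.eq_formalMultilinearSeries
    (spectrum.hasFPowerSeriesOnBall_inverse_one_sub_smul ℂ T).hasFPowerSeriesAt
  have hk := congrArg (fun p : FormalMultilinearSeries ℂ ℂ (X →L[ℂ] X) => p k fun _ => 1) heq
  simp only [cauchyPowerSeries_apply, ContinuousMultilinearMap.mkPiRing_apply, Finset.prod_const_one,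
    one_smul] at hk
  set Φ : ℝ → X →L[ℂ] X := fun θ =>
    ((circleMap 0 R θ)⁻¹) ^ k • Ring.inverse (1 - circleMap 0 R θ • T) with hΦ
  have hper : Function.Periodic Φ (2 * Real.pi) := fun θ => by
    simp only [hΦ, periodic_circleMap 0 (R : ℝ) θ]
  have hcirc : (∮ z in C(0, R), (1 / (z - 0)) ^ k • (z - 0)⁻¹ • Ring.inverse (1 - z • T)) =
      Complex.I • ∫ θ in (-Real.pi)..Real.pi, Φ θ := by
    have hshift := hper.intervalIntegral_add_eq 0 (-Real.pi)
    rw [zero_add, show -Real.pi + 2 * Real.pi = Real.pi by ring] at hshift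
    rw [← hshift, ← intervalIntegral.integral_smul, circleIntegral]
    refine intervalIntegral.integral_congr fun θ _ => ?_
    have h0 : circleMap 0 (R : ℝ) θ ≠ 0 := circleMap_ne_center (by rw [hRρ]; positivity)
    simp only [hΦ, deriv_circleMap, smul_smul, sub_zero, one_div]
    congr 1
    field_simp
  have hflip : ∀ θ, circleMap 0 ρ θ ^ (k + 1) • resolvent T (circleMap 0 ρ θ) = Φ (-θ) := by
    intro θ
    have h0 : circleMap 0 ρ θ ≠ 0 := circleMap_ne_center hρ0.ne'
    have hinv : circleMap 0 (R : ℝ) (-θ) = (circleMap 0 ρ θ)⁻¹ := by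
      rw [hRρ, circleMap_zero_inv]
    have hunit := spectrum.units_smul_resolvent_self (r := Units.mk0 _ h0) (a := T)
    simp only [Units.smul_def, Units.val_mk0, Units.val_inv_eq_inv_val] at hunit
    rw [pow_succ, mul_smul, hunit]
    simp [hΦ, hinv, resolvent]
  rw [hcirc, smul_smul] at hk
  simp only [hflip]
  rw [intervalIntegral.integral_comp_neg (f := Φ), neg_neg, ← hk, smul_smul]
  have : (2 * Real.pi : ℂ) * ((2 * Real.pi * Complex.I)⁻¹ * Complex.I) = 1 := by
    have := Complex.ofReal_ne_zero.mpr Real.pi_ne_zero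
    have := Complex.I_ne_zero
    field_simp
  rw [this, one_smul]

/-- The Cauchy formula behind the estimate: `p(T) = (2π)⁻¹ ∫ G(w) (R(w, T) - R(w / q, T)) dθ`,
where `G(z) - G(qz) = z p(z)`. -/
theorem integral_dilation_quotient_smul {T : X →L[ℂ] X}
    (hT : spectrum ℂ T ⊆ Metric.closedBall 0 1) {r q : ℝ} (hr : 1 < r) (hq0 : 0 < q) (hq1 : q < 1)
    (s : Finset ℕ) (c : ℕ → ℂ) :
    ∫ θ in (-Real.pi)..Real.pi,
      (∑ k ∈ s, c k / (1 - (q : ℂ) ^ (k + 1)) * circleMap 0 r θ ^ (k + 1)) •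
        (resolvent T (circleMap 0 r θ) - resolvent T (circleMap 0 (r / q) θ)) =
      (2 * Real.pi : ℂ) • ∑ k ∈ s, c k • T ^ k := by
  have hrq : 1 < r / q := by
    rw [lt_div_iff₀ hq0]
    linarith
  have hc1 := continuous_resolvent_circleMap hT hr
  have hc2 := continuous_resolvent_circleMap hT hrq
  have hcm := continuous_circleMap 0 r
  simp only [Finset.sum_smul]
  rw [intervalIntegral.integral_finsetSum fun k _ => by
    apply Continuous.intervalIntegrable
    fun_prop, Finset.smul_sum]
  refine Finset.sum_congr rfl fun k _ => ?_
  have hq : (q : ℂ) ≠ 0 := by exact_mod_cast hq0.ne'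
  have hd : (1 : ℂ) - (q : ℂ) ^ (k + 1) ≠ 0 := by
    have h1 : (1 : ℝ) - q ^ (k + 1) ≠ 0 :=
      (sub_pos.mpr (pow_lt_one₀ hq0.le hq1 (by omega))).ne'
    exact_mod_cast h1
  -- Writing `w = q (w/q)` turns this into Cauchy's formula on the circle of radius `r/q`; the
  -- factor `1 - q^(k+1)` left by subtraction cancels the denominator in `G`.
  have h2 : ∫ θ in (-Real.pi)..Real.pi,
      circleMap 0 r θ ^ (k + 1) • resolvent T (circleMap 0 (r / q) θ) =
      (q : ℂ) ^ (k + 1) • (2 * Real.pi : ℂ) • T ^ k := by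
    rw [← integral_pow_smul_resolvent hT hrq k, ← intervalIntegral.integral_smul]
    refine intervalIntegral.integral_congr fun θ _ => ?_
    simp only [smul_smul, ← mul_pow]
    congr 2
    simp only [circleMap, zero_add]
    push_cast
    field_simp
  simp only [smul_sub, mul_smul]
  rw [intervalIntegral.integral_sub
    (Continuous.intervalIntegrable (by fun_prop) _ _)
    (Continuous.intervalIntegrable (by fun_prop) _ _), intervalIntegral.integral_smul,
    intervalIntegral.integral_smul, integral_pow_smul_resolvent hT hr k, h2]
  simp only [smul_smul, ← sub_smul]
  congr 1
  field_simp

end Operator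

/-! ### The resolvent difference in `L¹`. -/

section Kernel

variable {X : Type*} [NormedAddCommGroup X] [NormedSpace ℂ X]

theorem norm_circleMap_exp {δ : ℝ} (θ : ℝ) : ‖circleMap 0 (Real.exp δ) θ‖ = Real.exp δ := by
  rw [norm_circleMap_zero, abs_of_pos (Real.exp_pos _)]

theorem IsTadmorRitt.norm_resolvent_circleMap_le_max {T : X →L[ℂ] X} (hT : IsTadmorRitt T)
    {δ θ : ℝ} (hδ : 0 < δ) (hθ : |θ| ≤ Real.pi) :
    ‖resolvent T (circleMap 0 (Real.exp δ) θ)‖ ≤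
      tadmorRittConst T * (Real.pi / 2) * (max (Real.pi / 2 * δ) |θ|)⁻¹ := by
  have hC := tadmorRittConst_nonneg T
  have hπ := Real.pi_pos
  have h1 : 1 < Real.exp δ := Real.one_lt_exp_iff.mpr hδ
  refine (hT.norm_resolvent_le (by rwa [norm_circleMap_exp])).trans ?_
  rw [div_eq_mul_inv, mul_assoc]
  have hmax : 0 < max (Real.pi / 2 * δ) |θ| := lt_max_of_lt_left (by positivity)
  have key : 2 / Real.pi * max (Real.pi / 2 * δ) |θ| ≤ ‖circleMap 0 (Real.exp δ) θ - 1‖ := by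
    rw [mul_max_of_nonneg _ _ (by positivity)]
    refine max_le ?_ ?_
    · refine le_trans ?_ (sub_one_le_norm_circleMap_sub_one (Real.exp_pos δ).le θ)
      have := Real.add_one_le_exp δ
      have : 2 / Real.pi * (Real.pi / 2 * δ) = δ := by field_simp
      linarith
    · refine le_trans ?_ (sqrt_mul_le_norm_circleMap_sub_one (Real.exp_pos δ).le hθ)
      exact le_mul_of_one_le_left (by positivity) (Real.one_le_sqrt.mpr h1.le)
  refine mul_le_mul_of_nonneg_left ?_ hC
  calc ‖circleMap 0 (Real.exp δ) θ - 1‖⁻¹ ≤ (2 / Real.pi * max (Real.pi / 2 * δ) |θ|)⁻¹ :=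
        inv_anti₀ (by positivity) key
    _ = _ := by rw [mul_inv, inv_div]

theorem IsTadmorRitt.norm_resolvent_circleMap_le {T : X →L[ℂ] X} (hT : IsTadmorRitt T)
    {δ θ : ℝ} (hδ : 0 < δ) (hθ0 : θ ≠ 0) (hθ : |θ| ≤ Real.pi) :
    ‖resolvent T (circleMap 0 (Real.exp δ) θ)‖ ≤
      tadmorRittConst T * (Real.exp (-(δ / 2)) * (Real.pi / 2) / |θ|) := by
  have hC := tadmorRittConst_nonneg T
  have hπ := Real.pi_pos
  have h1 : 1 < Real.exp δ := Real.one_lt_exp_iff.mpr hδ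
  refine (hT.norm_resolvent_le (by rwa [norm_circleMap_exp])).trans ?_
  rw [div_eq_mul_inv]
  have hθ' : 0 < |θ| := abs_pos.mpr hθ0
  have hsq : √(Real.exp δ) = Real.exp (δ / 2) := (Real.exp_half δ).symm
  have key := sqrt_mul_le_norm_circleMap_sub_one (Real.exp_pos δ).le hθ
  rw [hsq] at key
  refine mul_le_mul_of_nonneg_left ?_ hC
  refine (inv_anti₀ (by positivity) key).trans_eq ?_
  rw [Real.exp_neg]
  field_simp

theorem exp_sub_exp_neg_le {x : ℝ} (hx0 : 0 ≤ x) (hx1 : x ≤ 1) :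
    Real.exp x - Real.exp (-x) ≤ 3 * x := by
  have h1 := abs_le.mp (Real.abs_exp_sub_one_sub_id_le (x := x) (abs_le.mpr ⟨by linarith, hx1⟩))
  have h2 := Real.add_one_le_exp (-x)
  nlinarith [h1.2]

/-- The resolvent identity gives a product of two resolvents, hence the decay `θ⁻²`. The distance
between the two points is `2 e^(δ+x) sinh x`, and the two factors `√ρ` absorb `e^(δ+x)`. -/
theorem IsTadmorRitt.norm_resolvent_sub_resolvent_le {T : X →L[ℂ] X} (hT : IsTadmorRitt T)
    {δ x θ : ℝ} (hδ : 0 < δ) (hx0 : 0 < x) (hx1 : x ≤ 1) (hθ0 : θ ≠ 0) (hθ : |θ| ≤ Real.pi) :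
    ‖resolvent T (circleMap 0 (Real.exp δ) θ) - resolvent T (circleMap 0 (Real.exp (δ + 2 * x)) θ)‖
      ≤ 3 * x * (tadmorRittConst T * (Real.pi / 2)) ^ 2 / θ ^ 2 := by
  have hC := tadmorRittConst_nonneg T
  have hπ := Real.pi_pos
  have hδ' : 0 < δ + 2 * x := by positivity
  have hm : ∀ {d : ℝ}, 0 < d → circleMap 0 (Real.exp d) θ ∈ resolventSet ℂ T := fun {d} hd =>
    hT.mem_resolventSet (by rw [norm_circleMap_exp]; exact Real.one_lt_exp_iff.mpr hd)
  rw [resolvent_sub_resolvent_eq_smul (hm hδ) (hm hδ'), norm_smul]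
  have hdist : ‖circleMap 0 (Real.exp (δ + 2 * x)) θ - circleMap 0 (Real.exp δ) θ‖ =
      Real.exp (δ + x) * (Real.exp x - Real.exp (-x)) := by
    have h1 : Real.exp (δ + x) * (Real.exp x - Real.exp (-x)) =
        Real.exp (δ + 2 * x) - Real.exp δ := by
      rw [mul_sub, ← Real.exp_add, ← Real.exp_add]
      ring_nf
    have h2 : 0 ≤ Real.exp (δ + 2 * x) - Real.exp δ :=
      sub_nonneg.mpr (Real.exp_le_exp.mpr (by linarith))
    rw [h1, circleMap, circleMap, zero_add, zero_add, ← sub_mul, norm_mul,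
      Complex.norm_exp_ofReal_mul_I, mul_one, ← Complex.ofReal_sub, Complex.norm_of_nonneg h2]
  rw [hdist]
  have hprod := (norm_mul_le (resolvent T (circleMap 0 (Real.exp δ) θ))
    (resolvent T (circleMap 0 (Real.exp (δ + 2 * x)) θ))).trans
    (mul_le_mul (hT.norm_resolvent_circleMap_le hδ hθ0 hθ)
      (hT.norm_resolvent_circleMap_le hδ' hθ0 hθ) (norm_nonneg _) (by positivity))
  have he : Real.exp (δ + x) * (Real.exp (-(δ / 2)) * Real.exp (-((δ + 2 * x) / 2))) = 1 := by
    rw [← Real.exp_add, ← Real.exp_add, ← Real.exp_zero]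
    ring_nf
  calc _ ≤ Real.exp (δ + x) * (3 * x) * _ :=
        mul_le_mul (mul_le_mul_of_nonneg_left (exp_sub_exp_neg_le hx0.le hx1) (Real.exp_pos _).le)
          hprod (norm_nonneg _) (by positivity)
    _ = (Real.exp (δ + x) * (Real.exp (-(δ / 2)) * Real.exp (-((δ + 2 * x) / 2)))) *
          (3 * x * (tadmorRittConst T * (Real.pi / 2)) ^ 2 / |θ| ^ 2) := by
        field_simp
    _ = _ := by rw [he, one_mul, sq_abs]

/-- The `L¹` norm of the kernel `R(w, T) - R(e²ˣ w, T)` on the circle of radius `exp δ`. -/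
theorem IsTadmorRitt.integral_norm_resolvent_sub_resolvent_le [CompleteSpace X] {T : X →L[ℂ] X}
    (hT : IsTadmorRitt T) (hC : 1 ≤ tadmorRittConst T) {δ x : ℝ} (hδ : 0 < δ) (hx1 : x ≤ 1)
    (hδx : δ ≤ x) :
    ∫ θ in (-Real.pi)..Real.pi, ‖resolvent T (circleMap 0 (Real.exp δ) θ) -
        resolvent T (circleMap 0 (Real.exp (δ + 2 * x)) θ)‖ ≤
      Real.pi * tadmorRittConst T *
        (3 + Real.log (9 / 2) + 2 * Real.log (tadmorRittConst T) + Real.log (x / δ)) := by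
  set C := tadmorRittConst T with hCdef
  have hπ := Real.pi_pos
  have hx0 : 0 < x := hδ.trans_le hδx
  have hc : ∀ {d : ℝ}, 0 < d → Continuous fun θ => resolvent T (circleMap 0 (Real.exp d) θ) :=
    fun {d} hd => continuous_resolvent_circleMap hT.1 (Real.one_lt_exp_iff.mpr hd)
  set k : ℝ → ℝ := fun θ => ‖resolvent T (circleMap 0 (Real.exp δ) θ) -
    resolvent T (circleMap 0 (Real.exp (δ + 2 * x)) θ)‖ with hk
  have hkc : Continuous k := ((hc hδ).sub (hc (by positivity))).norm
  have hmax : ∀ θ, |θ| ≤ Real.pi → k θ ≤ C * (Real.pi / 2) *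
      ((max (Real.pi / 2 * δ) |θ|)⁻¹ + (max (Real.pi * x) |θ|)⁻¹) := by
    intro θ hθ
    rw [mul_add]
    refine (norm_sub_le _ _).trans (add_le_add (hT.norm_resolvent_circleMap_le_max hδ hθ) ?_)
    refine (hT.norm_resolvent_circleMap_le_max (by positivity) hθ).trans ?_
    have : 0 < max (Real.pi * x) |θ| := lt_max_of_lt_left (by positivity)
    -- The outer scale `(π/2)(δ + 2x)` is lowered to `πx`.
    refine mul_le_mul_of_nonneg_left (inv_anti₀ this (max_le_max_right _ ?_)) (by positivity)
    nlinarith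
  have hsq : ∀ θ, θ ≠ 0 → |θ| ≤ Real.pi → k θ ≤ 3 * x * (C * (Real.pi / 2)) ^ 2 / θ ^ 2 :=
    fun θ hθ0 hθ => hT.norm_resolvent_sub_resolvent_le hδ hx0 hx1 hθ0 hθ
  -- The cutoff `U = 3C(π/2)x` makes the tail `E/U` equal to the prefactor `B = Cπ/2`, turning the
  -- constant `2` into `3`.
  have hU : 3 * C * (Real.pi / 2) * x / (Real.pi / 2 * δ) = 3 * C * (x / δ) := by field_simp
  have hU' : 3 * C * (Real.pi / 2) * x / (Real.pi * x) = 3 / 2 * C := by field_simp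
  have hE : 3 * x * (C * (Real.pi / 2)) ^ 2 / (3 * C * (Real.pi / 2) * x) = C * (Real.pi / 2) := by
    field_simp
  have hlog : Real.log (3 * C * (x / δ)) + Real.log (3 / 2 * C) =
      Real.log (9 / 2) + 2 * Real.log C + Real.log (x / δ) := by
    have h9 : Real.log (9 / 2) = Real.log 3 + Real.log (3 / 2) := by
      rw [← Real.log_mul (by norm_num) (by norm_num)]
      norm_num
    rw [Real.log_mul (by positivity) (by positivity), Real.log_mul (by positivity) (by positivity),
      Real.log_mul (by positivity) (by positivity), h9]
    ring
  have hhalf : ∀ f : ℝ → ℝ, Continuous f →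
      (∀ θ, 0 ≤ θ → θ ≤ Real.pi → f θ ≤ C * (Real.pi / 2) *
        ((max (Real.pi / 2 * δ) θ)⁻¹ + (max (Real.pi * x) θ)⁻¹)) →
      (∀ θ, 0 < θ → θ ≤ Real.pi → f θ ≤ 3 * x * (C * (Real.pi / 2)) ^ 2 / θ ^ 2) →
      ∫ θ in (0 : ℝ)..Real.pi, f θ ≤ C * (Real.pi / 2) *
        (3 + Real.log (9 / 2) + 2 * Real.log C + Real.log (x / δ)) := by
    intro f hf h₁ h₂
    have h := integral_le_of_two_scales hf (U := 3 * C * (Real.pi / 2) * x)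
      (show 0 < Real.pi / 2 * δ by positivity) (show 0 < Real.pi * x by positivity)
      (by
        have : (Real.pi / 2) * δ ≤ (Real.pi / 2) * x := by gcongr
        have : (Real.pi / 2 * x) * 1 ≤ (Real.pi / 2 * x) * (3 * C) :=
          mul_le_mul_of_nonneg_left (by linarith) (by positivity)
        linarith)
      (by
        have : (Real.pi * x) * 1 ≤ (Real.pi * x) * (3 / 2 * C) :=
          mul_le_mul_of_nonneg_left (by linarith) (by positivity)
        linarith)
      (by positivity) (by positivity) hπ.le h₁ h₂
    rw [hU, hU', hE, add_assoc, hlog] at h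
    linarith
  have hsplit : ∫ θ in (-Real.pi)..Real.pi, k θ =
      (∫ θ in (0 : ℝ)..Real.pi, k (-θ)) + ∫ θ in (0 : ℝ)..Real.pi, k θ := by
    rw [intervalIntegral.integral_comp_neg (f := k), neg_zero,
      intervalIntegral.integral_add_adjacent_intervals (hkc.intervalIntegrable _ _)
        (hkc.intervalIntegrable _ _)]
  rw [hsplit]
  have h1 := hhalf k hkc
    (fun θ h0 h => by simpa only [abs_of_nonneg h0] using hmax θ (by rwa [abs_of_nonneg h0]))
    (fun θ h0 h => hsq θ h0.ne' (by rwa [abs_of_pos h0]))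
  have h2 := hhalf (fun θ => k (-θ)) (hkc.comp continuous_neg)
    (fun θ h0 h => by
      simpa only [abs_neg, abs_of_nonneg h0] using hmax (-θ) (by rwa [abs_neg, abs_of_nonneg h0]))
    (fun θ h0 h => by
      simpa only [neg_sq] using
        hsq (-θ) (neg_ne_zero.mpr h0.ne') (by rwa [abs_neg, abs_of_pos h0]))
  linarith

end Kernel

/-! ### Constants and conclusion. -/

theorem Polynomial.norm_eval_le_supNormOn_ball (p : Polynomial ℂ) {z : ℂ} (hz : ‖z‖ ≤ 1) :
    ‖p.eval z‖ ≤ supNormOn (Metric.ball (0 : ℂ) 1) fun z => p.eval z := by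
  have hbdd : BddAbove (Set.range fun z : Metric.ball (0 : ℂ) 1 => ‖p.eval (z : ℂ)‖) := by
    have h := ((isCompact_closedBall (0 : ℂ) 1).image p.continuous.norm).bddAbove
    refine h.mono ?_
    rintro _ ⟨w, rfl⟩
    exact ⟨w, Metric.ball_subset_closedBall w.2, rfl⟩
  have hcl : IsClosed {z : ℂ | ‖p.eval z‖ ≤
      supNormOn (Metric.ball (0 : ℂ) 1) fun z => p.eval z} :=
    isClosed_le p.continuous.norm continuous_const
  have hsub : Metric.ball (0 : ℂ) 1 ⊆ {z : ℂ | ‖p.eval z‖ ≤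
      supNormOn (Metric.ball (0 : ℂ) 1) fun z => p.eval z} :=
    fun w hw => le_ciSup hbdd ⟨w, hw⟩
  have := closure_minimal hsub hcl
  rw [closure_ball _ one_ne_zero] at this
  exact this (by simpa using hz)

/-- Replacing `1 - e⁻²` by `π/4` makes the final prefactor exactly `2e/π`. -/
theorem pi_div_four_le_one_sub_exp_neg_two : Real.pi / 4 ≤ 1 - Real.exp (-2) := by
  have h1 := Real.pi_lt_d2
  have h2 : Real.exp (-2) = (Real.exp 1 * Real.exp 1)⁻¹ := by
    rw [← Real.exp_add, ← Real.exp_neg]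
    norm_num
  have h3 := Real.exp_one_gt_d9
  have h4 : (5 : ℝ) ≤ Real.exp 1 * Real.exp 1 := by nlinarith
  have h5 : (Real.exp 1 * Real.exp 1)⁻¹ ≤ (5 : ℝ)⁻¹ := inv_anti₀ (by norm_num) h4
  rw [h2]
  norm_num at h5 ⊢
  linarith

/-- Bounds the kernel constant `3 + log(9/2)` by `6`. -/
theorem log_nine_halves_le_three : Real.log (9 / 2) ≤ 3 := by
  rw [Real.log_le_iff_le_exp (by norm_num)]
  have h : Real.exp 3 = Real.exp 1 ^ 3 := by
    rw [← Real.exp_nat_mul]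
    norm_num
  rw [h]
  nlinarith [Real.exp_one_gt_d9, sq_nonneg (Real.exp 1)]

/-- Functional calculus estimate for polynomials of a Tadmor–Ritt operator, with explicit
constants. -/
theorem IsTadmorRitt.norm_sum_smul_pow_le {X : Type*} [NormedAddCommGroup X] [NormedSpace ℂ X]
    [CompleteSpace X] {T : X →L[ℂ] X} (hT : IsTadmorRitt T) (hC : 1 ≤ tadmorRittConst T)
    {m n : ℕ} (hmn : m ≤ n) (c : ℕ → ℂ) {S : ℝ}
    (hS : ∀ z : ℂ, ‖z‖ = 1 → ‖∑ k ∈ Finset.Icc m n, c k * z ^ k‖ ≤ S) :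
    ‖∑ k ∈ Finset.Icc m n, c k • T ^ k‖ ≤
      2 * Real.exp 1 / Real.pi * tadmorRittConst T * (2 * Real.log (tadmorRittConst T) + 6 +
        Real.log (((n : ℝ) + 1) / ((m : ℝ) + 1))) * S := by
  set C := tadmorRittConst T
  have hπ := Real.pi_pos
  have hS0 : 0 ≤ S := (norm_nonneg _).trans (hS 1 norm_one)
  -- With these scales `r^(n+1) = e` and `q^(m+1) = e⁻²`, so the bound of `G` does not depend on `m`
  -- and `n`.
  set δ : ℝ := ((n : ℝ) + 1)⁻¹ with hδdef
  set x : ℝ := ((m : ℝ) + 1)⁻¹ with hxdef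
  have hδ : 0 < δ := by positivity
  have hx0 : 0 < x := by positivity
  have hδx : δ ≤ x := by
    refine inv_anti₀ (by positivity) ?_
    exact_mod_cast Nat.succ_le_succ hmn
  have hx1 : x ≤ 1 := inv_le_one_of_one_le₀ (by simp)
  have hxδ : x / δ = ((n : ℝ) + 1) / ((m : ℝ) + 1) := by
    rw [hδdef, hxdef]
    field_simp
  have hq1 : Real.exp (-(2 * x)) < 1 := Real.exp_lt_one_iff.mpr (by linarith)
  have hr1 : 1 < Real.exp δ := Real.one_lt_exp_iff.mpr hδ
  have hrq : Real.exp δ / Real.exp (-(2 * x)) = Real.exp (δ + 2 * x) := by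
    rw [← Real.exp_sub, sub_neg_eq_add]
  have hqM : Real.exp (-(2 * x)) ^ (m + 1) = Real.exp (-2) := by
    rw [← Real.exp_nat_mul, hxdef]
    congr 1
    push_cast
    field_simp
  have hrN : Real.exp δ ^ (n + 1) = Real.exp 1 := by
    rw [← Real.exp_nat_mul, hδdef]
    congr 1
    push_cast
    field_simp
  have hcauchy := integral_dilation_quotient_smul hT.1 hr1 (Real.exp_pos (-(2 * x))) hq1
    (Finset.Icc m n) c
  rw [hrq] at hcauchy
  have hG : ∀ θ : ℝ, ‖∑ k ∈ Finset.Icc m n, c k / (1 - (Real.exp (-(2 * x)) : ℂ) ^ (k + 1)) *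
      circleMap 0 (Real.exp δ) θ ^ (k + 1)‖ ≤ Real.exp 1 * (S / (1 - Real.exp (-2))) := by
    intro θ
    have h := norm_sum_dilation_quotient_le hmn c (Real.exp_pos (-(2 * x))).le hq1 hS
      (w := circleMap 0 (Real.exp δ) θ) (by rw [norm_circleMap_exp]; exact hr1.le)
    rwa [norm_circleMap_exp, hqM, hrN] at h
  have hker := hT.integral_norm_resolvent_sub_resolvent_le hC hδ hx1 hδx
  have hcont : Continuous fun θ => resolvent T (circleMap 0 (Real.exp δ) θ) -
      resolvent T (circleMap 0 (Real.exp (δ + 2 * x)) θ) :=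
    (continuous_resolvent_circleMap hT.1 hr1).sub
      (continuous_resolvent_circleMap hT.1 (Real.one_lt_exp_iff.mpr (by positivity)))
  have hint := intervalIntegral.norm_integral_le_of_norm_le (μ := MeasureTheory.volume)
    (neg_le_self hπ.le)
    (MeasureTheory.ae_of_all _ fun θ _ => (norm_smul_le (∑ k ∈ Finset.Icc m n,
      c k / (1 - (Real.exp (-(2 * x)) : ℂ) ^ (k + 1)) * circleMap 0 (Real.exp δ) θ ^ (k + 1))
      (resolvent T (circleMap 0 (Real.exp δ) θ) -
        resolvent T (circleMap 0 (Real.exp (δ + 2 * x)) θ))).trans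
      (mul_le_mul_of_nonneg_right (hG θ) (norm_nonneg _)))
    ((continuous_const.mul hcont.norm).intervalIntegrable _ _)
  have h2π : ‖(2 * Real.pi : ℂ)‖ = 2 * Real.pi := by
    rw [norm_mul, Complex.norm_of_nonneg hπ.le, Complex.norm_ofNat]
  rw [hcauchy, norm_smul, intervalIntegral.integral_const_mul, h2π] at hint
  rw [← hxδ]
  set P := ‖∑ k ∈ Finset.Icc m n, c k • T ^ k‖
  set Y := 2 * Real.log C + 6 + Real.log (x / δ) with hY
  have hlogC : 0 ≤ Real.log C := Real.log_nonneg hC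
  have hL : 0 ≤ Real.log (x / δ) := Real.log_nonneg ((one_le_div hδ).mpr hδx)
  have hker' : _ ≤ Real.pi * C * Y := hker.trans
    (mul_le_mul_of_nonneg_left (by linarith [log_nine_halves_le_three]) (by positivity))
  have hS' : S / (1 - Real.exp (-2)) ≤ 4 / Real.pi * S := by
    have hd := pi_div_four_le_one_sub_exp_neg_two
    calc S / (1 - Real.exp (-2)) ≤ S / (Real.pi / 4) :=
          div_le_div_of_nonneg_left hS0 (by positivity) hd
      _ = _ := by field_simp
  have hfin : 2 * Real.pi * P ≤ Real.exp 1 * (4 / Real.pi * S) * (Real.pi * C * Y) := by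
    refine hint.trans (mul_le_mul (mul_le_mul_of_nonneg_left hS' (Real.exp_pos 1).le) hker' ?_
      (by positivity))
    exact intervalIntegral.integral_nonneg (neg_le_self hπ.le) fun θ _ => norm_nonneg _
  refine le_of_mul_le_mul_left (hfin.trans_eq ?_) (show 0 < 2 * Real.pi by positivity)
  field_simp
  ring

theorem theorem2 {X : Type*} [NormedAddCommGroup X] [NormedSpace ℂ X] [CompleteSpace X]
    (T : X →L[ℂ] X) (hT : IsTadmorRitt T) (m n : ℕ) (hmn : m ≤ n)
    (c : ℕ → ℂ) (p : Polynomial ℂ)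
    (hp : p = ∑ k ∈ Finset.Icc m n, Polynomial.monomial k (c k))
    (s : ℝ) (hs₀ : 0 < s) (hs₁ : s < 1) :
    ‖Polynomial.aeval T p‖ ≤
      (2 * Real.exp 1 / (Real.pi * (1 - s))) * tadmorRittConst T *
        (2 * Real.log (tadmorRittConst T) + (-2 * Real.log s + 6)
          + Real.log (((n : ℝ) + 1) / ((m : ℝ) + 1))) *
        supNormOn (Metric.ball (0 : ℂ) 1) (fun z => p.eval z) := by
  rcases subsingleton_or_nontrivial X with hX | hX
  · have hop : ∀ A : X →L[ℂ] X, ‖A‖ = 0 := fun A => by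
      rw [show A = 0 from ContinuousLinearMap.ext fun v => Subsingleton.elim _ _, norm_zero]
    have hC : tadmorRittConst T = 0 := by simp [tadmorRittConst, rittValue, hop]
    rw [hop, hC]
    simp
  have hC := hT.one_le_tadmorRittConst
  have heval : ∀ z, p.eval z = ∑ k ∈ Finset.Icc m n, c k * z ^ k := fun z => by
    simp [hp, Polynomial.eval_finsetSum]
  have haeval : Polynomial.aeval T p = ∑ k ∈ Finset.Icc m n, c k • T ^ k := by
    simp [hp, Polynomial.aeval_monomial, Algebra.algebraMap_eq_smul_one]
  have hS : ∀ z : ℂ, ‖z‖ ≤ 1 → ‖p.eval z‖ ≤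
      supNormOn (Metric.ball (0 : ℂ) 1) fun z => p.eval z :=
    fun z hz => p.norm_eval_le_supNormOn_ball hz
  have hS0 := (norm_nonneg _).trans (hS 0 (by simp))
  rw [haeval]
  -- The bound obtained here is free of `s`; since `1 - s ≤ 1` and `-2 log s ≥ 0`, inserting `s`
  -- only weakens it.
  refine (hT.norm_sum_smul_pow_le hC hmn c fun z hz => heval z ▸ hS z hz.le).trans ?_
  have hπ := Real.pi_pos
  have hlogs : Real.log s ≤ 0 := Real.log_nonpos hs₀.le hs₁.le
  have hlogC : 0 ≤ Real.log (tadmorRittConst T) := Real.log_nonneg hC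
  have hL : 0 ≤ Real.log (((n : ℝ) + 1) / ((m : ℝ) + 1)) := by
    refine Real.log_nonneg ((one_le_div (by positivity)).mpr ?_)
    exact_mod_cast Nat.succ_le_succ hmn
  have h1s : 0 < 1 - s := by linarith
  refine mul_le_mul_of_nonneg_right ?_ hS0
  refine mul_le_mul (mul_le_mul_of_nonneg_right ?_ (by linarith)) (by linarith) (by linarith)
    (by positivity)
  exact div_le_div_of_nonneg_left (by positivity) (by positivity)
    (mul_le_of_le_one_right hπ.le (by linarith))
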